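/- Let $X=(X_t)_{t\ge 0}$ be a real-valued Lévy process with càdlàg paths and $X_0=0$ a.s., and let $N$ be a Poisson process with rate $\lambda>0$ independent of $X$, both defined on a probability space $(\Omega,\mathcal F,\mathbb P)$. Let $\mathcal T=\{T_1,T_2,\dots\}$ be the set of jump times of $N$, let $\mathbb F$ be the filtration generated by $(X,N)$, and let $\bar{\mathcal A}$ be the set of $\mathbb F$-stopping times $\tau$ such that $\tau\in\mathcal T\cup\{0,\infty\}$ a.s. Fix a discount factor $r>0$ and a strike price $K>0$, and set $G_p(x)=(K-x)^+$ and $G_c(x)=(x-K)^+$. For $s>0$ and $i\in\{p,c\}$ define $$\bar V_i(s)=\sup_{\tau\in\bar{\mathcal A}}\mathbb E\big[e^{-r\tau}G_i(S_\tau)1_{\{\tau<\infty\}}\big],\qquad S_t=s\,e^{X_t}.$$ Then $\bar V_p$ is finite and convex on $(0,\infty)$. If moreover $\mathbb E[e^{X_1}]<e^{r}$, then $\bar V_c$ is finite and convex on $(0,\infty)$. -/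

import Mathlib

open MeasureTheory ProbabilityTheory Set Filter
open scoped NNReal ENNReal Topology

noncomputable section

/-- Right-continuous with left limits. At `0` the left-limit condition is void. -/
def IsCadlagPath (f : ℝ≥0 → ℝ) : Prop :=
  ∀ t : ℝ≥0, ContinuousWithinAt f (Ici t) t ∧ ∃ l : ℝ, Tendsto f (𝓝[<] t) (𝓝 l)

/-- A real Lévy process started at `0`. -/
structure IsLevyProcess {Ω : Type*} [MeasurableSpace Ω] (X : ℝ≥0 → Ω → ℝ) (P : Measure Ω) :
    Prop where
  measurable : ∀ t, Measurable (X t)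
  cadlag : ∀ ω, IsCadlagPath (fun t => X t ω)
  start_zero : ∀ᵐ ω ∂P, X 0 ω = 0
  indep_increments : HasIndepIncrements X P
  stationary_increments : ∀ t h : ℝ≥0,
    IdentDistrib (fun ω => X (t + h) ω - X t ω) (fun ω => X h ω - X 0 ω) P P

/-- A Poisson process of rate `lam`: a Lévy process with values in `ℕ` whose value at time `t`
is Poisson distributed with mean `lam * t`. -/
structure IsPoissonProcess {Ω : Type*} [MeasurableSpace Ω] (N : ℝ≥0 → Ω → ℕ) (lam : ℝ≥0)
    (P : Measure Ω) : Prop where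
  measurable : ∀ t, Measurable (N t)
  levy : IsLevyProcess (fun t ω => (N t ω : ℝ)) P
  law : ∀ t : ℝ≥0, HasLaw (N t) (poissonMeasure (lam * t)) P

/-- The filtration generated by the pair `(X, N)`. -/
def generatedFiltration {Ω : Type*} [mΩ : MeasurableSpace Ω] (X : ℝ≥0 → Ω → ℝ)
    (N : ℝ≥0 → Ω → ℕ) (hX : ∀ t, Measurable (X t)) (hN : ∀ t, Measurable (N t)) :
    Filtration ℝ≥0 mΩ :=
  Filtration.natural (fun t ω => (X t ω, N t ω))
    (fun t => ((hX t).prodMk (hN t)).stronglyMeasurable)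

/-- The set `{T₁, T₂, …}` of jump times of the path `t ↦ N t ω`
(right-continuous paths have no jump at `0`). -/
def jumpTimes {Ω : Type*} (N : ℝ≥0 → Ω → ℕ) (ω : Ω) : Set ℝ≥0 :=
  {t | ¬ ContinuousAt (fun u => N u ω) t}

/-- Stopping times that almost surely take values in the jump times of `N`, `0` or `∞`. -/
def extendedStrategies {Ω : Type*} [mΩ : MeasurableSpace Ω] (P : Measure Ω)
    (𝓕 : Filtration ℝ≥0 mΩ) (N : ℝ≥0 → Ω → ℕ) : Set (Ω → WithTop ℝ≥0) :=
  {τ | IsStoppingTime 𝓕 τ ∧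
    ∀ᵐ ω ∂P, τ ω = ⊤ ∨ ∃ t ∈ insert (0 : ℝ≥0) (jumpTimes N ω), τ ω = (t : WithTop ℝ≥0)}

/-- The random variable `e^{-r τ} G(S_τ) 1_{τ < ∞}` (for `G ≥ 0`). -/
def discountedPayoff {Ω : Type*} (r : ℝ) (G : ℝ → ℝ) (S : ℝ≥0 → Ω → ℝ)
    (τ : Ω → WithTop ℝ≥0) (ω : Ω) : ℝ≥0∞ :=
  if τ ω = ⊤ then 0
  else ENNReal.ofReal
    (Real.exp (-r * ((τ ω).untopD 0 : ℝ≥0)) * G (S ((τ ω).untopD 0) ω))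

/-- The value function of the problem in which immediate stopping is allowed, as a function of
the initial price `s`: under `P_s` the price is `S_t = s e^{X_t}` with `X` started at `0`. -/
def extendedValue {Ω : Type*} [mΩ : MeasurableSpace Ω] (P : Measure Ω)
    (𝓕 : Filtration ℝ≥0 mΩ) (X : ℝ≥0 → Ω → ℝ) (N : ℝ≥0 → Ω → ℕ) (r : ℝ) (G : ℝ → ℝ)
    (s : ℝ) : ℝ≥0∞ :=
  ⨆ τ ∈ extendedStrategies P 𝓕 N,
    ∫⁻ ω, discountedPayoff r G (fun t ω => s * Real.exp (X t ω)) τ ω ∂P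

/-- The put payoff `(K - s)⁺`. -/
def putPayoff (K s : ℝ) : ℝ := max (K - s) 0

/-- The call payoff `(s - K)⁺`. -/
def callPayoff (K s : ℝ) : ℝ := max (s - K) 0

end

/-! The admissible stopping times do not depend on `s`. For a fixed one, the expected payoff is
convex in `s`, because the price is linear in `s` and the payoff is convex; a supremum of convex
functions is convex wherever it is finite (`convexOn_toReal_extendedValue`). What remains is
finiteness. The put payoff is at most `K`. The call payoff is at most the price, so it suffices that
`E[e^{X_τ - rτ}; τ < ∞] ≤ 1` for every stopping time
(`IsLevyProcess.lintegral_discountedExp_stopped_le`). Since `E[e^{X_1}] ≤ e^r`, the discounted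
exponential is a nonnegative supermartingale along each dyadic grid, also for the filtration
enlarged by the independent `N`. Optional stopping on the grids, right-continuity and Fatou's lemma
give the bound. -/

/-! ### Independence of the increments of `X` from the joint past of `(X, N)`. -/

/-- If `U` is independent of `V` and the pair `(U, V)` is independent of `W`, then the pair `(U, W)`
is independent of `V`. -/
theorem ProbabilityTheory.IndepFun.prodMk_left_of_prodMk {Ω α β γ : Type*} {mΩ : MeasurableSpace Ω}
    [MeasurableSpace α] [MeasurableSpace β] [MeasurableSpace γ] {P : Measure Ω}
    [IsProbabilityMeasure P] {U : Ω → α} {V : Ω → β} {W : Ω → γ}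
    (hU : Measurable U) (hV : Measurable V) (hW : Measurable W)
    (hUV : IndepFun U V P) (hUVW : IndepFun (fun ω => (U ω, V ω)) W P) :
    IndepFun (fun ω => (U ω, W ω)) V P := by
  have hUW : IndepFun U W P := hUVW.comp measurable_fst measurable_id
  refine IndepSets.indep (p1 := preimage (fun ω => (U ω, W ω)) ''
      (image2 (· ×ˢ ·) {s : Set α | MeasurableSet s} {t : Set γ | MeasurableSet t}))
    (p2 := {s | MeasurableSet[MeasurableSpace.comap V inferInstance] s})
    (hU.prodMk hW).comap_le hV.comap_le (isPiSystem_prod.comap _)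
    (@MeasurableSpace.isPiSystem_measurableSet _ (MeasurableSpace.comap V inferInstance)) ?_
    (@MeasurableSpace.generateFrom_measurableSet _ (MeasurableSpace.comap V inferInstance)).symm ?_
  · rw [← MeasurableSpace.comap_generateFrom, generateFrom_prod]
  · rw [IndepSets_iff]
    rintro _ _ ⟨_, ⟨A, hA, C, hC, rfl⟩, rfl⟩ ⟨B, hB, rfl⟩
    have h1 := hUVW.measure_inter_preimage_eq_mul _ _ ((show MeasurableSet A from hA).prod hB) hC
    have h2 := hUV.measure_inter_preimage_eq_mul _ _ hA hB
    have h3 := hUW.measure_inter_preimage_eq_mul _ _ hA hC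
    have e1 : (fun ω => (U ω, W ω)) ⁻¹' (A ×ˢ C) = U ⁻¹' A ∩ W ⁻¹' C := rfl
    have e2 : (fun ω => (U ω, V ω)) ⁻¹' (A ×ˢ B) = U ⁻¹' A ∩ V ⁻¹' B := rfl
    rw [e2, h2] at h1
    rw [e1, h3, inter_right_comm, h1]
    ring

/-- For a process with independent increments that starts at `0`, the increment after time `s` is
independent of the path up to time `s`. -/
theorem ProbabilityTheory.HasIndepIncrements.indepFun_process_sub {Ω : Type*}
    {mΩ : MeasurableSpace Ω} {P : Measure Ω} [IsProbabilityMeasure P] {X : ℝ≥0 → Ω → ℝ}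
    (hX : HasIndepIncrements X P) (hm : ∀ t, Measurable (X t)) (h0 : ∀ᵐ ω ∂P, X 0 ω = 0)
    {s t : ℝ≥0} (hst : s ≤ t) :
    IndepFun (fun ω (u : Iic s) => X u ω) (fun ω => X t ω - X s ω) P := by
  refine IndepFun.process_indepFun (fun u => hm u) ((hm t).sub (hm s)) fun I => ?_
  classical
  -- With `0` and `s` added to the grid, each `X u` is a sum of increments from time `0`, and `X t -
  -- X s` is the next increment after the grid. `τ` lists the grid in increasing order and then
  -- stays at `t`.
  set J : Finset ℝ≥0 := insert 0 (insert s (I.image Subtype.val)) with hJ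
  have hJs : ∀ u ∈ J, u ≤ s := by
    intro u hu
    simp only [hJ, Finset.mem_insert, Finset.mem_image] at hu
    rcases hu with rfl | rfl | ⟨v, -, rfl⟩
    · exact zero_le
    · exact le_rfl
    · exact v.2
  have hJ0 : (0 : ℝ≥0) ∈ J := by simp [hJ]
  have hsJ : s ∈ J := by simp [hJ]
  obtain ⟨n, hn⟩ : ∃ n, J.card = n + 1 :=
    Nat.exists_eq_succ_of_ne_zero (Finset.card_pos.2 ⟨0, hJ0⟩).ne'
  let τ : ℕ → ℝ≥0 := fun k => if h : k < n + 1 then J.orderEmbOfFin hn ⟨k, h⟩ else t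
  have hτlt : ∀ k (h : k < n + 1), τ k = J.orderEmbOfFin hn ⟨k, h⟩ := fun k h => dif_pos h
  have hτge : ∀ k, ¬ k < n + 1 → τ k = t := fun k h => dif_neg h
  have hτJ : ∀ k, k < n + 1 → τ k ∈ J := by
    intro k hk
    rw [hτlt k hk]
    exact Finset.orderEmbOfFin_mem _ _ _
  have hτsurj : ∀ u ∈ J, ∃ k < n + 1, τ k = u := by
    intro u hu
    have : u ∈ Set.range (J.orderEmbOfFin hn) := by rw [Finset.range_orderEmbOfFin]; exact hu
    obtain ⟨k, rfl⟩ := this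
    exact ⟨k, k.2, hτlt k k.2⟩
  have hτ : Monotone τ := by
    intro a b hab
    by_cases hb : b < n + 1
    · rw [hτlt b hb, hτlt a (hab.trans_lt hb)]
      exact (J.orderEmbOfFin hn).monotone hab
    · by_cases ha : a < n + 1
      · rw [hτge b hb]
        exact (hJs _ (hτJ a ha)).trans hst
      · rw [hτge a ha, hτge b hb]
  have hτ0 : τ 0 = 0 := by
    obtain ⟨k, hk, h⟩ := hτsurj 0 hJ0
    exact le_antisymm (h ▸ hτ (Nat.zero_le k)) zero_le
  have hτn : τ n = s := by
    obtain ⟨k, hk, h⟩ := hτsurj s hsJ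
    exact le_antisymm (hJs _ (hτJ n n.lt_succ_self)) (h ▸ hτ (Nat.lt_succ_iff.1 hk))
  have hτn1 : τ (n + 1) = t := hτge _ (lt_irrefl _)
  have hind := (hX.nat hτ).indepFun_finset (Finset.range n) {n} (by simp)
    (fun i => (hm _).sub (hm _))
  have hidx : ∀ i : I, ∃ k ≤ n, τ k = (i : Iic s) := by
    intro i
    obtain ⟨k, hk, h⟩ := hτsurj i (by
      simp only [hJ, Finset.mem_insert, Finset.mem_image]
      exact Or.inr (Or.inr ⟨i, i.2, rfl⟩))
    exact ⟨k, Nat.lt_succ_iff.1 hk, h⟩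
  choose k hkn hk using hidx
  -- Telescoping recovers the value of `X` at the grid point of index `k i`.
  let φ : (↥(Finset.range n) → ℝ) → I → ℝ := fun x i =>
    ∑ j : Finset.range n, if (j : ℕ) < k i then x j else 0
  have hφ : Measurable φ := by
    refine measurable_pi_lambda _ fun i => Finset.measurable_sum _ fun j _ => ?_
    split_ifs
    · exact measurable_pi_apply j
    · exact measurable_const
  let ψ : (({n} : Finset ℕ) → ℝ) → ℝ := fun x => x ⟨n, by simp⟩
  refine (hind.comp hφ (measurable_pi_apply _ : Measurable ψ)).congr ?_ ?_
  · filter_upwards [h0] with ω hω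
    ext i
    simp only [φ, Function.comp]
    rw [Finset.sum_coe_sort (Finset.range n)
      (fun j => if j < k i then X (τ (j + 1)) ω - X (τ j) ω else 0), ← Finset.sum_filter]
    have : (Finset.range n).filter (· < k i) = Finset.range (k i) := by
      ext j
      simpa using fun h => lt_of_lt_of_le h (hkn i)
    rw [this, Finset.sum_range_sub (fun j => X (τ j) ω), hk, hτ0, hω, sub_zero]
  · refine Eventually.of_forall fun ω => ?_
    simp [hτn, hτn1]

/-- The increment is independent even of the past of `X` together with the entire path of `N`, of
which the past of `(X, N)` is a function. -/
theorem IsLevyProcess.indep_generatedFiltration {Ω : Type*} {mΩ : MeasurableSpace Ω}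
    {P : Measure Ω} [IsProbabilityMeasure P] {X : ℝ≥0 → Ω → ℝ} {N : ℝ≥0 → Ω → ℕ}
    (hX : IsLevyProcess X P) (hN : ∀ t, Measurable (N t))
    (hXN : IndepFun (fun ω t => X t ω) (fun ω t => N t ω) P) {s t : ℝ≥0} (hst : s ≤ t) :
    Indep (generatedFiltration X N hX.measurable hN s)
      (MeasurableSpace.comap (fun ω => X t ω - X s ω) inferInstance) P := by
  have hUV := hX.indep_increments.indepFun_process_sub hX.measurable hX.start_zero hst
  have hφ : Measurable fun x : ℝ≥0 → ℝ => ((fun u : Iic s => x u), x t - x s) := by fun_prop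
  have hUW := IndepFun.prodMk_left_of_prodMk (W := fun ω t => N t ω)
    (measurable_pi_lambda _ fun u : Iic s => hX.measurable u)
    ((hX.measurable t).sub (hX.measurable s)) (measurable_pi_lambda _ hN) hUV
    (hXN.comp hφ measurable_id)
  have hψ : Measurable fun x : (Iic s → ℝ) × (ℝ≥0 → ℕ) => fun u : Iic s => (x.1 u, x.2 u) := by
    fun_prop
  have := hUW.comp hψ measurable_id
  rw [generatedFiltration, Filtration.natural_eq_comap]
  exact this

/-! ### Dyadic approximation of times from the right, and measurability. -/

/-- The first point of the dyadic grid of mesh `2⁻ⁿ` that is strictly larger than `t`. -/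
noncomputable def nextDyadic (n : ℕ) (t : ℝ≥0) : ℝ≥0 := (⌊t * 2 ^ n⌋₊ + 1 : ℕ) * (1 / 2) ^ n

theorem le_nextDyadic (n : ℕ) (t : ℝ≥0) : t ≤ nextDyadic n t := by
  have h := (Nat.lt_floor_add_one (t * 2 ^ n)).le
  rw [nextDyadic, one_div, inv_pow, ← div_eq_mul_inv, le_div_iff₀ (by positivity)]
  exact_mod_cast h

theorem nextDyadic_le_add (n : ℕ) (t : ℝ≥0) : nextDyadic n t ≤ t + (1 / 2) ^ n := by
  have h := Nat.floor_le (zero_le (a := t * 2 ^ n))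
  rw [nextDyadic, Nat.cast_add, Nat.cast_one, add_mul, one_mul]
  gcongr
  rw [one_div, inv_pow, ← div_eq_mul_inv, div_le_iff₀ (by positivity)]
  exact h

theorem tendsto_nextDyadic (t : ℝ≥0) :
    Tendsto (fun n => nextDyadic n t) atTop (𝓝[≥] t) := by
  refine tendsto_nhdsWithin_iff.2 ⟨?_, Eventually.of_forall fun n => le_nextDyadic n t⟩
  refine tendsto_of_tendsto_of_tendsto_of_le_of_le tendsto_const_nhds ?_
    (fun n => le_nextDyadic n t) (fun n => nextDyadic_le_add n t)
  have : Tendsto (fun n : ℕ => (1 / 2 : ℝ≥0) ^ n) atTop (𝓝 0) :=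
    tendsto_pow_atTop_nhds_zero_of_lt_one (by norm_num) (by
      rw [← NNReal.coe_lt_coe]; norm_num)
  simpa using tendsto_const_nhds.add this

/-- The value of a càdlàg path at `t` is the limit of its values at the dyadic times after `t`. -/
theorem IsCadlagPath.tendsto_nextDyadic {f : ℝ≥0 → ℝ} (hf : IsCadlagPath f) (t : ℝ≥0) :
    Tendsto (fun n => f (nextDyadic n t)) atTop (𝓝 (f t)) :=
  ((hf t).1).tendsto.comp (_root_.tendsto_nextDyadic t)

theorem measurable_eval_nextDyadic {Ω : Type*} [MeasurableSpace Ω] {X : ℝ≥0 → Ω → ℝ}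
    (hX : ∀ t, Measurable (X t)) {T : Ω → ℝ≥0} (hT : Measurable T) (n : ℕ) :
    Measurable fun ω => X (nextDyadic n (T ω)) ω := by
  -- At a fixed level the grid is countable, so joint measurability in index and `ω` needs no path
  -- regularity.
  have h : Measurable fun p : ℕ × Ω => X ((p.1 + 1 : ℕ) * (1 / 2) ^ n) p.2 :=
    measurable_from_prod_countable_right fun k =>
      hX ((k + 1 : ℕ) * (1 / 2) ^ n)
  have hfl : Measurable fun ω => ⌊T ω * 2 ^ n⌋₊ := Nat.measurable_floor.comp (hT.mul_const _)
  exact h.comp (hfl.prodMk measurable_id)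

theorem measurable_eval_of_isCadlagPath {Ω : Type*} [MeasurableSpace Ω] {X : ℝ≥0 → Ω → ℝ}
    (hX : ∀ t, Measurable (X t)) (hc : ∀ ω, IsCadlagPath fun t => X t ω) {T : Ω → ℝ≥0}
    (hT : Measurable T) : Measurable fun ω => X (T ω) ω :=
  measurable_of_tendsto_metrizable (measurable_eval_nextDyadic hX hT)
    (tendsto_pi_nhds.2 fun ω => (hc ω).tendsto_nextDyadic (T ω))

theorem measurableSet_eq_top_of_isStoppingTime {Ω : Type*} {mΩ : MeasurableSpace Ω}
    {𝓕 : Filtration ℝ≥0 mΩ} {τ : Ω → WithTop ℝ≥0} (hτ : IsStoppingTime 𝓕 τ) :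
    MeasurableSet {ω | τ ω = ⊤} := by
  have : {ω | τ ω = ⊤} = ⋂ n : ℕ, {ω | τ ω ≤ (n : ℝ≥0)}ᶜ := by
    ext ω
    simp only [mem_ofPred_eq, mem_iInter, mem_compl_iff, not_le]
    constructor
    · intro h n
      rw [h]
      exact WithTop.coe_lt_top _
    · intro h
      by_contra hne
      obtain ⟨t, ht⟩ := WithTop.ne_top_iff_exists.1 hne
      obtain ⟨n, hn⟩ := exists_nat_ge t
      have := h n
      rw [← ht, WithTop.coe_lt_coe] at this
      exact absurd hn this.not_ge
  rw [this]
  exact MeasurableSet.iInter fun n => (𝓕.le _ _ (hτ.measurableSet_le _)).compl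

theorem measurable_untopD_of_isStoppingTime {Ω : Type*} {mΩ : MeasurableSpace Ω}
    {𝓕 : Filtration ℝ≥0 mΩ} {τ : Ω → WithTop ℝ≥0} (hτ : IsStoppingTime 𝓕 τ) :
    Measurable fun ω => (τ ω).untopD 0 := by
  refine measurable_of_Iic fun a => ?_
  -- `untopD 0` sends `⊤` to `0`, so the event `τ = ⊤` lies in every such preimage.
  have : (fun ω => (τ ω).untopD 0) ⁻¹' Iic a = {ω | τ ω ≤ a} ∪ {ω | τ ω = ⊤} := by
    ext ω
    simp only [mem_preimage, mem_Iic, mem_union, mem_ofPred_eq]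
    cases h : τ ω with
    | top => simp
    | coe t =>
      rw [WithTop.untopD_coe, WithTop.coe_le_coe]
      exact ⟨Or.inl, fun h => h.resolve_right (WithTop.coe_ne_top)⟩
  rw [this]
  exact (𝓕.le _ _ (hτ.measurableSet_le a)).union (measurableSet_eq_top_of_isStoppingTime hτ)

theorem measurable_discountedPayoff {Ω : Type*} {mΩ : MeasurableSpace Ω}
    {𝓕 : Filtration ℝ≥0 mΩ} {τ : Ω → WithTop ℝ≥0} (hτ : IsStoppingTime 𝓕 τ)
    {X : ℝ≥0 → Ω → ℝ} (hX : ∀ t, Measurable (X t)) (hc : ∀ ω, IsCadlagPath fun t => X t ω)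
    {G : ℝ → ℝ} (hG : Measurable G) (r s : ℝ) :
    Measurable (discountedPayoff r G (fun t ω => s * Real.exp (X t ω)) τ) := by
  have hT := measurable_untopD_of_isStoppingTime hτ
  have hXT := measurable_eval_of_isCadlagPath hX hc hT
  unfold discountedPayoff
  refine Measurable.ite (measurableSet_eq_top_of_isStoppingTime hτ) measurable_const ?_
  refine ENNReal.measurable_ofReal.comp (Measurable.mul ?_ (hG.comp ?_))
  · exact Real.measurable_exp.comp (measurable_const.mul (measurable_coe_nnreal_real.comp hT))
  · exact measurable_const.mul (Real.measurable_exp.comp hXT)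

/-! ### Supermartingale property and optional stopping. -/

/-- The discounted price `e^{X_t - r t}` with initial value `1`. -/
noncomputable def discountedExp {Ω : Type*} (X : ℝ≥0 → Ω → ℝ) (r : ℝ) (t : ℝ≥0) (ω : Ω) : ℝ≥0∞ :=
  ENNReal.ofReal (Real.exp (X t ω - r * t))

theorem IsLevyProcess.lintegral_exp_sub {Ω : Type*} {mΩ : MeasurableSpace Ω} {P : Measure Ω}
    {X : ℝ≥0 → Ω → ℝ} (hX : IsLevyProcess X P) (s h : ℝ≥0) :
    ∫⁻ ω, ENNReal.ofReal (Real.exp (X (s + h) ω - X s ω)) ∂P =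
      ∫⁻ ω, ENNReal.ofReal (Real.exp (X h ω)) ∂P := by
  have hg : Measurable fun x : ℝ => ENNReal.ofReal (Real.exp x) := by fun_prop
  refine ((hX.stationary_increments s h).comp hg).lintegral_eq.trans ?_
  refine lintegral_congr_ae ?_
  filter_upwards [hX.start_zero] with ω hω
  simp [hω]

theorem IsLevyProcess.lintegral_exp_two_mul {Ω : Type*} {mΩ : MeasurableSpace Ω} {P : Measure Ω}
    {X : ℝ≥0 → Ω → ℝ} (hX : IsLevyProcess X P) (h : ℝ≥0) :
    ∫⁻ ω, ENNReal.ofReal (Real.exp (X (2 * h) ω)) ∂P =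
      (∫⁻ ω, ENNReal.ofReal (Real.exp (X h ω)) ∂P) ^ 2 := by
  have hg : Measurable fun x : ℝ => ENNReal.ofReal (Real.exp x) := by fun_prop
  have hind := (hX.indep_increments.indepFun_eval_sub (zero_le (a := h))
    (by rw [two_mul]; exact le_self_add : h ≤ 2 * h) hX.start_zero).comp hg hg
  have := lintegral_mul_eq_lintegral_mul_lintegral_of_indepFun (hg.comp (hX.measurable h))
    (hg.comp ((hX.measurable (2 * h)).sub (hX.measurable h))) hind
  simp only [Function.comp, Pi.mul_apply, Pi.sub_apply] at this
  rw [two_mul] at this ⊢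
  rw [hX.lintegral_exp_sub h h] at this
  rw [sq, ← this]
  refine lintegral_congr fun ω => ?_
  rw [← ENNReal.ofReal_mul (Real.exp_pos _).le, ← Real.exp_add, add_sub_cancel]

/-- Halving the time takes the square root of the exponential moment, so the bound at time `1`
descends to every `2⁻ⁿ`. -/
theorem IsLevyProcess.lintegral_exp_dyadic_le {Ω : Type*} {mΩ : MeasurableSpace Ω} {P : Measure Ω}
    {X : ℝ≥0 → Ω → ℝ} (hX : IsLevyProcess X P) {r : ℝ}
    (h : ∫⁻ ω, ENNReal.ofReal (Real.exp (X 1 ω)) ∂P ≤ ENNReal.ofReal (Real.exp r)) (n : ℕ) :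
    ∫⁻ ω, ENNReal.ofReal (Real.exp (X ((1 / 2) ^ n) ω)) ∂P ≤
      ENNReal.ofReal (Real.exp (r * (1 / 2) ^ n)) := by
  induction n with
  | zero => simpa using h
  | succ n ih =>
    have h2 : ((1 / 2) ^ n : ℝ≥0) = 2 * (1 / 2) ^ (n + 1) := by
      rw [pow_succ, mul_comm ((1 / 2 : ℝ≥0) ^ n), ← mul_assoc]; norm_num
    rw [h2, hX.lintegral_exp_two_mul] at ih
    refine (ENNReal.pow_le_pow_left_iff two_ne_zero).1 (ih.trans_eq ?_)
    rw [← ENNReal.ofReal_pow (Real.exp_pos _).le, ← Real.exp_nat_mul]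
    congr 2
    rw [pow_succ]
    push_cast
    ring

/-- The supermartingale inequality for one time step, tested on an event of the past: the new factor
`e^{X_{s+h} - X_s}` is independent of that past and has mean at most `e^{rh}`. -/
theorem IsLevyProcess.setLIntegral_discountedExp_add_le {Ω : Type*} {mΩ : MeasurableSpace Ω}
    {P : Measure Ω} [IsProbabilityMeasure P] {X : ℝ≥0 → Ω → ℝ} {N : ℝ≥0 → Ω → ℕ}
    (hX : IsLevyProcess X P) (hN : ∀ t, Measurable (N t))
    (hXN : IndepFun (fun ω t => X t ω) (fun ω t => N t ω) P) {r : ℝ} {h : ℝ≥0}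
    (hh : ∫⁻ ω, ENNReal.ofReal (Real.exp (X h ω)) ∂P ≤ ENNReal.ofReal (Real.exp (r * h)))
    (s : ℝ≥0) {A : Set Ω} (hA : MeasurableSet[generatedFiltration X N hX.measurable hN s] A) :
    ∫⁻ ω in A, discountedExp X r (s + h) ω ∂P ≤ ∫⁻ ω in A, discountedExp X r s ω ∂P := by
  set 𝓕 := generatedFiltration X N hX.measurable hN
  have hA' : MeasurableSet A := 𝓕.le s _ hA
  have hXs : Measurable[𝓕 s] (X s) := by
    have : Measurable[𝓕 s] fun ω => (X s ω, N s ω) :=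
      (Filtration.stronglyAdapted_natural
        (fun t => ((hX.measurable t).prodMk (hN t)).stronglyMeasurable) s).measurable
    exact measurable_fst.comp this
  have hf : Measurable[𝓕 s] (A.indicator (discountedExp X r s)) := by
    refine Measurable.indicator ?_ hA
    unfold discountedExp
    have : Measurable fun x : ℝ => ENNReal.ofReal (Real.exp (x - r * s)) := by fun_prop
    exact this.comp hXs
  have hg : Measurable[MeasurableSpace.comap (fun ω => X (s + h) ω - X s ω) inferInstance]
      fun ω => ENNReal.ofReal (Real.exp (X (s + h) ω - X s ω)) := by
    have : Measurable fun x : ℝ => ENNReal.ofReal (Real.exp x) := by fun_prop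
    exact this.comp (comap_measurable _)
  have key := lintegral_mul_eq_lintegral_mul_lintegral_of_independent_measurableSpace
    (𝓕.le s) ((hX.measurable (s + h)).sub (hX.measurable s)).comap_le
    (hX.indep_generatedFiltration hN hXN le_self_add) hf hg
  rw [hX.lintegral_exp_sub] at key
  have hc : ENNReal.ofReal (Real.exp (-(r * h))) * ENNReal.ofReal (Real.exp (r * h)) = 1 := by
    rw [← ENNReal.ofReal_mul (Real.exp_pos _).le, ← Real.exp_add]; simp
  rw [← lintegral_indicator hA', ← lintegral_indicator hA']
  calc ∫⁻ ω, A.indicator (discountedExp X r (s + h)) ω ∂P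
      = ∫⁻ ω, ENNReal.ofReal (Real.exp (-(r * h))) * (A.indicator (discountedExp X r s) ω *
          ENNReal.ofReal (Real.exp (X (s + h) ω - X s ω))) ∂P := by
        refine lintegral_congr fun ω => ?_
        by_cases hω : ω ∈ A
        · simp only [hω, indicator_of_mem, discountedExp]
          rw [← ENNReal.ofReal_mul (Real.exp_pos _).le, ← ENNReal.ofReal_mul (Real.exp_pos _).le,
            ← Real.exp_add, ← Real.exp_add]
          congr 2
          push_cast
          ring
        · simp [hω]
    _ = ENNReal.ofReal (Real.exp (-(r * h))) * ((∫⁻ ω, A.indicator (discountedExp X r s) ω ∂P) *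
          ∫⁻ ω, ENNReal.ofReal (Real.exp (X h ω)) ∂P) := by
        rw [lintegral_const_mul' _ _ ENNReal.ofReal_ne_top, key]
    _ ≤ ENNReal.ofReal (Real.exp (-(r * h))) * ((∫⁻ ω, A.indicator (discountedExp X r s) ω ∂P) *
          ENNReal.ofReal (Real.exp (r * h))) := by gcongr
    _ = ∫⁻ ω, A.indicator (discountedExp X r s) ω ∂P := by
        rw [mul_left_comm, hc, mul_one]

/-- Optional stopping in discrete time for a nonnegative supermartingale: the stopping time equals
`k + 1` on `A k \ A (k + 1)`. -/
theorem tsum_setLIntegral_diff_le {Ω : Type*} {mΩ : MeasurableSpace Ω} {P : Measure Ω}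
    {Z : ℕ → Ω → ℝ≥0∞} {A : ℕ → Set Ω} (hA : ∀ k, MeasurableSet (A k)) (hanti : Antitone A)
    (hstep : ∀ k, ∫⁻ ω in A k, Z (k + 1) ω ∂P ≤ ∫⁻ ω in A k, Z k ω ∂P) :
    ∑' k, ∫⁻ ω in A k \ A (k + 1), Z (k + 1) ω ∂P ≤ ∫⁻ ω in A 0, Z 0 ω ∂P := by
  -- Keeping the term for the paths not yet stopped makes the induction close.
  have H : ∀ m, ∑ k ∈ Finset.range m, ∫⁻ ω in A k \ A (k + 1), Z (k + 1) ω ∂P +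
      ∫⁻ ω in A m, Z m ω ∂P ≤ ∫⁻ ω in A 0, Z 0 ω ∂P := by
    intro m
    induction m with
    | zero => simp
    | succ m ih =>
      refine le_trans ?_ ih
      rw [Finset.sum_range_succ, add_assoc]
      gcongr
      refine le_trans (le_of_eq ?_) (hstep m)
      have := lintegral_inter_add_sdiff (μ := P) (Z (m + 1)) (A m) (hA (m + 1))
      rw [inter_eq_self_of_subset_right (hanti m.le_succ)] at this
      rw [← this, add_comm]
  rw [ENNReal.tsum_eq_iSup_nat]
  exact iSup_le fun m => le_self_add.trans (H m)

theorem floor_mul_two_pow_eq_iff (n k : ℕ) (t : ℝ≥0) :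
    ⌊t * 2 ^ n⌋₊ = k ↔ (k : ℝ≥0) * (1 / 2) ^ n ≤ t ∧ t < (k + 1 : ℕ) * (1 / 2) ^ n := by
  rw [Nat.floor_eq_iff zero_le, one_div, inv_pow, ← div_eq_mul_inv, ← div_eq_mul_inv,
    div_le_iff₀ (by positivity), lt_div_iff₀ (by positivity)]
  push_cast
  rfl

/-- Optional stopping at the dyadic approximation from above of a stopping time. -/
theorem IsLevyProcess.lintegral_discountedExp_nextDyadic_le {Ω : Type*} {mΩ : MeasurableSpace Ω}
    {P : Measure Ω} [IsProbabilityMeasure P] {X : ℝ≥0 → Ω → ℝ} {N : ℝ≥0 → Ω → ℕ}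
    (hX : IsLevyProcess X P) (hN : ∀ t, Measurable (N t))
    (hXN : IndepFun (fun ω t => X t ω) (fun ω t => N t ω) P) {r : ℝ}
    (h : ∫⁻ ω, ENNReal.ofReal (Real.exp (X 1 ω)) ∂P ≤ ENNReal.ofReal (Real.exp r))
    {τ : Ω → WithTop ℝ≥0} (hτ : IsStoppingTime (generatedFiltration X N hX.measurable hN) τ)
    (n : ℕ) :
    ∫⁻ ω in {ω | τ ω = ⊤}ᶜ, discountedExp X r (nextDyadic n ((τ ω).untopD 0)) ω ∂P ≤ 1 := by
  set 𝓕 := generatedFiltration X N hX.measurable hN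
  set δ : ℝ≥0 := (1 / 2) ^ n with hδ
  -- `A k` is known at time `kδ`. On `A k \ A (k + 1)` one has `kδ ≤ τ < (k + 1)δ`, so the
  -- approximating time is `(k + 1)δ`, also when `τ = kδ`.
  let A : ℕ → Set Ω := fun k => {ω | ((k * δ : ℝ≥0) : WithTop ℝ≥0) ≤ τ ω}
  have hAF : ∀ k : ℕ, MeasurableSet[𝓕 (k * δ)] (A k) := fun k => hτ.measurableSet_ge _
  have hA : ∀ k, MeasurableSet (A k) := fun k => 𝓕.le _ _ (hAF k)
  have hanti : Antitone A := by
    intro a b hab ω hω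
    refine le_trans (WithTop.coe_le_coe.2 ?_) (show ((b * δ : ℝ≥0) : WithTop ℝ≥0) ≤ τ ω from hω)
    gcongr
  have hfloor : ∀ k ω, ω ∈ A k \ A (k + 1) ↔
      τ ω ≠ ⊤ ∧ ⌊(τ ω).untopD 0 * 2 ^ n⌋₊ = k := by
    intro k ω
    rw [floor_mul_two_pow_eq_iff, ← hδ, Set.mem_sdiff]
    change (((k * δ : ℝ≥0) : WithTop ℝ≥0) ≤ τ ω ∧
      ¬ ((((k + 1 : ℕ) * δ : ℝ≥0) : WithTop ℝ≥0) ≤ τ ω)) ↔ _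
    cases τ ω with
    | top => simp
    | coe t =>
      rw [WithTop.untopD_coe, WithTop.coe_le_coe, WithTop.coe_le_coe, not_le]
      exact ⟨fun h => ⟨WithTop.coe_ne_top, h⟩, fun h => h.2⟩
  have hU : {ω | τ ω = ⊤}ᶜ = ⋃ k, A k \ A (k + 1) := by
    ext ω
    simp [hfloor]
  have hdisj : Pairwise (Function.onFun Disjoint fun k => A k \ A (k + 1)) := by
    intro a b hab
    refine disjoint_left.2 fun ω ha hb => hab ?_
    rw [← ((hfloor a ω).1 ha).2, ← ((hfloor b ω).1 hb).2]
  have hstep : ∀ k : ℕ, ∫⁻ ω in A k, discountedExp X r ((k + 1 : ℕ) * δ) ω ∂P ≤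
      ∫⁻ ω in A k, discountedExp X r (k * δ) ω ∂P := by
    intro k
    have := hX.setLIntegral_discountedExp_add_le hN hXN (r := r) (h := δ)
      (by simpa [hδ] using hX.lintegral_exp_dyadic_le h n) (k * δ) (hAF k)
    rwa [← add_one_mul, ← Nat.cast_add_one] at this
  rw [hU, lintegral_iUnion (fun k => (hA k).diff (hA (k + 1))) hdisj]
  calc ∑' k, ∫⁻ ω in A k \ A (k + 1), discountedExp X r (nextDyadic n ((τ ω).untopD 0)) ω ∂P
      = ∑' k : ℕ, ∫⁻ ω in A k \ A (k + 1), discountedExp X r ((k + 1 : ℕ) * δ) ω ∂P := by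
        refine tsum_congr fun k => setLIntegral_congr_fun ((hA k).diff (hA (k + 1))) ?_
        intro ω hω
        simp only [nextDyadic, ((hfloor k ω).1 hω).2, hδ]
    _ ≤ ∫⁻ ω in A 0, discountedExp X r ((0 : ℕ) * δ) ω ∂P :=
        tsum_setLIntegral_diff_le (Z := fun k => discountedExp X r (k * δ)) hA hanti hstep
    _ ≤ ∫⁻ ω, discountedExp X r ((0 : ℕ) * δ) ω ∂P := setLIntegral_le_lintegral _ _
    _ = ∫⁻ _, 1 ∂P := by
        refine lintegral_congr_ae ?_
        filter_upwards [hX.start_zero] with ω hω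
        simp [discountedExp, hω]
    _ = 1 := by simp

/-- Right-continuity makes the dyadic values converge pointwise, and Fatou's lemma preserves their
uniform bound `1`. -/
theorem IsLevyProcess.lintegral_discountedExp_stopped_le {Ω : Type*} {mΩ : MeasurableSpace Ω}
    {P : Measure Ω} [IsProbabilityMeasure P] {X : ℝ≥0 → Ω → ℝ} {N : ℝ≥0 → Ω → ℕ}
    (hX : IsLevyProcess X P) (hN : ∀ t, Measurable (N t))
    (hXN : IndepFun (fun ω t => X t ω) (fun ω t => N t ω) P) {r : ℝ}
    (h : ∫⁻ ω, ENNReal.ofReal (Real.exp (X 1 ω)) ∂P ≤ ENNReal.ofReal (Real.exp r))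
    {τ : Ω → WithTop ℝ≥0} (hτ : IsStoppingTime (generatedFiltration X N hX.measurable hN) τ) :
    ∫⁻ ω in {ω | τ ω = ⊤}ᶜ, discountedExp X r ((τ ω).untopD 0) ω ∂P ≤ 1 := by
  have hT := measurable_untopD_of_isStoppingTime hτ
  have hg : Measurable fun p : ℝ × ℝ≥0 => ENNReal.ofReal (Real.exp (p.1 - r * p.2)) := by fun_prop
  have hmeas : ∀ n, Measurable fun ω => discountedExp X r (nextDyadic n ((τ ω).untopD 0)) ω := by
    intro n
    have h2 : Measurable fun ω => nextDyadic n ((τ ω).untopD 0) :=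
      ((measurable_of_countable fun k : ℕ => ((k + 1 : ℕ) : ℝ≥0)).comp
        (Nat.measurable_floor.comp (hT.mul_const _))).mul_const _
    exact hg.comp ((measurable_eval_nextDyadic hX.measurable hT n).prodMk h2)
  have hlim : ∀ ω, Tendsto (fun n => discountedExp X r (nextDyadic n ((τ ω).untopD 0)) ω) atTop
      (𝓝 (discountedExp X r ((τ ω).untopD 0) ω)) := by
    intro ω
    have h1 := (hX.cadlag ω).tendsto_nextDyadic ((τ ω).untopD 0)
    have h2 := (tendsto_nextDyadic ((τ ω).untopD 0)).mono_right nhdsWithin_le_nhds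
    have h3 := (NNReal.tendsto_coe.2 h2).const_mul r
    exact ENNReal.tendsto_ofReal ((Real.continuous_exp.tendsto _).comp (h1.sub h3))
  calc ∫⁻ ω in {ω | τ ω = ⊤}ᶜ, discountedExp X r ((τ ω).untopD 0) ω ∂P
      = ∫⁻ ω in {ω | τ ω = ⊤}ᶜ,
          liminf (fun n => discountedExp X r (nextDyadic n ((τ ω).untopD 0)) ω) atTop ∂P :=
        lintegral_congr fun ω => (hlim ω).liminf_eq.symm
    _ ≤ liminf (fun n => ∫⁻ ω in {ω | τ ω = ⊤}ᶜ,
          discountedExp X r (nextDyadic n ((τ ω).untopD 0)) ω ∂P) atTop :=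
        lintegral_liminf_le hmeas
    _ ≤ liminf (fun _ => (1 : ℝ≥0∞)) atTop :=
        liminf_le_liminf (Eventually.of_forall fun n =>
          hX.lintegral_discountedExp_nextDyadic_le hN hXN h hτ n)
    _ = 1 := by simp

/-! ### Finiteness and convexity of the value functions. -/

theorem extendedValue_callPayoff_le {Ω : Type*} {mΩ : MeasurableSpace Ω}
    {P : Measure Ω} [IsProbabilityMeasure P] {X : ℝ≥0 → Ω → ℝ} {N : ℝ≥0 → Ω → ℕ}
    (hX : IsLevyProcess X P) (hN : ∀ t, Measurable (N t))
    (hXN : IndepFun (fun ω t => X t ω) (fun ω t => N t ω) P) {r K : ℝ} (hK : 0 ≤ K)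
    (h : ∫⁻ ω, ENNReal.ofReal (Real.exp (X 1 ω)) ∂P ≤ ENNReal.ofReal (Real.exp r))
    {s : ℝ} (hs : 0 ≤ s) :
    extendedValue P (generatedFiltration X N hX.measurable hN) X N r (callPayoff K) s ≤
      ENNReal.ofReal s := by
  refine iSup₂_le fun τ hτ => ?_
  have hmt := (measurableSet_eq_top_of_isStoppingTime hτ.1).compl
  calc ∫⁻ ω, discountedPayoff r (callPayoff K) (fun t ω => s * Real.exp (X t ω)) τ ω ∂P
      ≤ ∫⁻ ω, ENNReal.ofReal s * ({ω | τ ω = ⊤}ᶜ).indicator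
          (fun ω => discountedExp X r ((τ ω).untopD 0) ω) ω ∂P := by
        refine lintegral_mono fun ω => ?_
        by_cases hω : τ ω = ⊤
        · simp [discountedPayoff, hω]
        · rw [indicator_of_mem (show ω ∈ {ω | τ ω = ⊤}ᶜ from hω), discountedPayoff, if_neg hω,
            discountedExp, ← ENNReal.ofReal_mul hs]
          refine ENNReal.ofReal_le_ofReal ?_
          set t := (τ ω).untopD 0
          have hc : callPayoff K (s * Real.exp (X t ω)) ≤ s * Real.exp (X t ω) :=
            max_le (by linarith) (by positivity)
          calc Real.exp (-r * t) * callPayoff K (s * Real.exp (X t ω))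
              ≤ Real.exp (-r * t) * (s * Real.exp (X t ω)) := by gcongr
            _ = s * Real.exp (X t ω - r * t) := by
              rw [sub_eq_add_neg, Real.exp_add, neg_mul]; ring
    _ = ENNReal.ofReal s *
          ∫⁻ ω in {ω | τ ω = ⊤}ᶜ, discountedExp X r ((τ ω).untopD 0) ω ∂P := by
        rw [lintegral_const_mul' _ _ ENNReal.ofReal_ne_top, lintegral_indicator hmt]
    _ ≤ ENNReal.ofReal s * 1 := by
        gcongr
        exact hX.lintegral_discountedExp_stopped_le hN hXN h hτ.1
    _ = ENNReal.ofReal s := mul_one _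

theorem extendedValue_putPayoff_le {Ω : Type*} {mΩ : MeasurableSpace Ω} {P : Measure Ω}
    [IsProbabilityMeasure P] {𝓕 : Filtration ℝ≥0 mΩ} {X : ℝ≥0 → Ω → ℝ} {N : ℝ≥0 → Ω → ℕ}
    {r K : ℝ} (hr : 0 ≤ r) (hK : 0 ≤ K) {s : ℝ} (hs : 0 ≤ s) :
    extendedValue P 𝓕 X N r (putPayoff K) s ≤ ENNReal.ofReal K := by
  refine iSup₂_le fun τ _ => ?_
  calc ∫⁻ ω, discountedPayoff r (putPayoff K) (fun t ω => s * Real.exp (X t ω)) τ ω ∂P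
      ≤ ∫⁻ _, ENNReal.ofReal K ∂P := by
        refine lintegral_mono fun ω => ?_
        by_cases hω : τ ω = ⊤
        · simp [discountedPayoff, hω]
        · rw [discountedPayoff, if_neg hω]
          refine ENNReal.ofReal_le_ofReal ?_
          set t := (τ ω).untopD 0
          have h0 : 0 ≤ s * Real.exp (X t ω) := by positivity
          have hp : putPayoff K (s * Real.exp (X t ω)) ≤ K := max_le (by linarith) hK
          have he : Real.exp (-r * t) ≤ 1 := by
            rw [Real.exp_le_one_iff, neg_mul, neg_nonpos]
            positivity
          calc Real.exp (-r * t) * putPayoff K (s * Real.exp (X t ω))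
              ≤ 1 * K := mul_le_mul he hp (le_max_right _ _) zero_le_one
            _ = K := one_mul K
    _ = ENNReal.ofReal K := by simp

theorem convexOn_putPayoff (K : ℝ) : ConvexOn ℝ univ (putPayoff K) :=
  ((convexOn_const K convex_univ).sub (concaveOn_id convex_univ)).sup
    (convexOn_const 0 convex_univ)

theorem convexOn_callPayoff (K : ℝ) : ConvexOn ℝ univ (callPayoff K) :=
  ((convexOn_id convex_univ).sub (concaveOn_const K convex_univ)).sup
    (convexOn_const 0 convex_univ)

/-- The set of strategies does not depend on the initial price, so the value function is a supremum
of convex functions when the payoff is convex. -/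
theorem convexOn_toReal_extendedValue {Ω : Type*} {mΩ : MeasurableSpace Ω} {P : Measure Ω}
    {𝓕 : Filtration ℝ≥0 mΩ} {X : ℝ≥0 → Ω → ℝ} {N : ℝ≥0 → Ω → ℕ} (hX : ∀ t, Measurable (X t))
    (hc : ∀ ω, IsCadlagPath fun t => X t ω) {r : ℝ} {G : ℝ → ℝ} (hG : Measurable G)
    (hG0 : ∀ x, 0 ≤ G x) (hGc : ConvexOn ℝ univ G)
    (hfin : ∀ s : ℝ, 0 < s → extendedValue P 𝓕 X N r G s ≠ ∞) :
    ConvexOn ℝ (Ioi (0 : ℝ)) fun s => (extendedValue P 𝓕 X N r G s).toReal := by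
  refine ⟨convex_Ioi 0, fun x hx y hy a b ha hb hab => ?_⟩
  have hxf := hfin x hx
  have hyf := hfin y hy
  -- The inequality is proved in `ℝ≥0∞`, where suprema always exist; finiteness at `x` and `y` then
  -- transfers it to `ℝ`.
  have key : extendedValue P 𝓕 X N r G (a • x + b • y) ≤
      ENNReal.ofReal a * extendedValue P 𝓕 X N r G x +
        ENNReal.ofReal b * extendedValue P 𝓕 X N r G y := by
    refine iSup₂_le fun τ hτ => ?_
    calc ∫⁻ ω, discountedPayoff r G (fun t ω => (a • x + b • y) * Real.exp (X t ω)) τ ω ∂P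
        ≤ ∫⁻ ω, (ENNReal.ofReal a * discountedPayoff r G (fun t ω => x * Real.exp (X t ω)) τ ω +
            ENNReal.ofReal b * discountedPayoff r G (fun t ω => y * Real.exp (X t ω)) τ ω) ∂P := by
          refine lintegral_mono fun ω => ?_
          by_cases hω : τ ω = ⊤
          · simp [discountedPayoff, hω]
          · simp only [discountedPayoff, if_neg hω]
            set t := (τ ω).untopD 0
            have he := Real.exp_pos (-r * t)
            rw [← ENNReal.ofReal_mul ha, ← ENNReal.ofReal_mul hb, ← ENNReal.ofReal_add
              (mul_nonneg ha (mul_nonneg he.le (hG0 _))) (mul_nonneg hb (mul_nonneg he.le (hG0 _)))]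
            refine ENNReal.ofReal_le_ofReal ?_
            have := hGc.2 (mem_univ (x * Real.exp (X t ω))) (mem_univ (y * Real.exp (X t ω)))
              ha hb hab
            simp only [smul_eq_mul] at this ⊢
            have e : (a * x + b * y) * Real.exp (X t ω) =
                a * (x * Real.exp (X t ω)) + b * (y * Real.exp (X t ω)) := by ring
            rw [e]
            refine (mul_le_mul_of_nonneg_left this he.le).trans_eq ?_
            ring
      _ = ENNReal.ofReal a * ∫⁻ ω, discountedPayoff r G (fun t ω => x * Real.exp (X t ω)) τ ω ∂P +
            ENNReal.ofReal b *
              ∫⁻ ω, discountedPayoff r G (fun t ω => y * Real.exp (X t ω)) τ ω ∂P := by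
          rw [lintegral_add_left
            ((measurable_discountedPayoff hτ.1 hX hc hG r x).const_mul _),
            lintegral_const_mul' _ _ ENNReal.ofReal_ne_top,
            lintegral_const_mul' _ _ ENNReal.ofReal_ne_top]
      _ ≤ _ := by
          gcongr
          · exact le_iSup₂_of_le τ hτ le_rfl
          · exact le_iSup₂_of_le τ hτ le_rfl
  have hxm := ENNReal.mul_ne_top (ENNReal.ofReal_ne_top (r := a)) hxf
  have hym := ENNReal.mul_ne_top (ENNReal.ofReal_ne_top (r := b)) hyf
  refine (ENNReal.toReal_mono (ENNReal.add_ne_top.2 ⟨hxm, hym⟩) key).trans_eq ?_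
  rw [ENNReal.toReal_add hxm hym, ENNReal.toReal_mul, ENNReal.toReal_mul,
    ENNReal.toReal_ofReal ha, ENNReal.toReal_ofReal hb, smul_eq_mul, smul_eq_mul]

theorem proposition3p1 {Ω : Type*} [MeasurableSpace Ω] (P : Measure Ω) [IsProbabilityMeasure P]
    (X : ℝ≥0 → Ω → ℝ) (N : ℝ≥0 → Ω → ℕ) (lam : ℝ≥0) (r K : ℝ)
    (hlam : 0 < lam) (hr : 0 < r) (hK : 0 < K)
    (hX : IsLevyProcess X P) (hN : IsPoissonProcess N lam P)
    (hXN : IndepFun (fun ω t => X t ω) (fun ω t => N t ω) P) :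
    ((∀ s : ℝ, 0 < s →
        extendedValue P (generatedFiltration X N hX.measurable hN.measurable) X N r
          (putPayoff K) s ≠ ∞) ∧
      ConvexOn ℝ (Ioi (0 : ℝ)) (fun s =>
        (extendedValue P (generatedFiltration X N hX.measurable hN.measurable) X N r
          (putPayoff K) s).toReal)) ∧
    (∫⁻ ω, ENNReal.ofReal (Real.exp (X 1 ω)) ∂P < ENNReal.ofReal (Real.exp r) →
      (∀ s : ℝ, 0 < s →
        extendedValue P (generatedFiltration X N hX.measurable hN.measurable) X N r
          (callPayoff K) s ≠ ∞) ∧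
      ConvexOn ℝ (Ioi (0 : ℝ)) (fun s =>
        (extendedValue P (generatedFiltration X N hX.measurable hN.measurable) X N r
          (callPayoff K) s).toReal)) := by
  have hput : ∀ s : ℝ, 0 < s →
      extendedValue P (generatedFiltration X N hX.measurable hN.measurable) X N r
        (putPayoff K) s ≠ ∞ := fun s hs =>
    ne_top_of_le_ne_top ENNReal.ofReal_ne_top (extendedValue_putPayoff_le hr.le hK.le hs.le)
  refine ⟨⟨hput, convexOn_toReal_extendedValue hX.measurable hX.cadlag
    (by unfold putPayoff; fun_prop) (fun _ => le_max_right _ _) (convexOn_putPayoff K) hput⟩,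
    fun hexp => ?_⟩
  have hcall : ∀ s : ℝ, 0 < s →
      extendedValue P (generatedFiltration X N hX.measurable hN.measurable) X N r
        (callPayoff K) s ≠ ∞ := fun s hs =>
    ne_top_of_le_ne_top ENNReal.ofReal_ne_top
      (extendedValue_callPayoff_le hX hN.measurable hXN hK.le hexp.le hs.le)
  exact ⟨hcall, convexOn_toReal_extendedValue hX.measurable hX.cadlag
    (by unfold callPayoff; fun_prop) (fun _ => le_max_right _ _) (convexOn_callPayoff K) hcall⟩
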